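/- Let $k\ge 1$ and let $Z_1,\dots,Z_k$ be independent real random variables, $Z_i$ having the gamma distribution with shape $\alpha_i>0$ and rate $\beta_i>0$, i.e. the density $\beta_i^{\alpha_i}t^{\alpha_i-1}e^{-\beta_i t}/\Gamma(\alpha_i)$ for $t>0$. Assume $(\alpha_i,\beta_i)\neq(\alpha_j,\beta_j)$ for $i\ne j$. For $t>0$ let $e[x_1,\dots,x_k]$ be the divided difference of the function $e(x)=e^{xt}$ at $x_1,\dots,x_k$: for pairwise distinct points it is given by $e[x_1]=e(x_1)$ and $$e[x_1,\dots,x_j]=\frac{e[x_2,\dots,x_j]-e[x_1,\dots,x_{j-1}]}{x_j-x_1},$$ and it is extended by continuity to coinciding points. For real orders $\nu_1,\dots,\nu_k>-1$ let $m_i$ be the least integer $\ge 0$ with $m_i\ge\nu_i$, and define the mixed Liouville fractional derivative of $g:\mathbb R^k\to\mathbb R$ by $${}_{-\infty}D_{x_1}^{\nu_1}\cdots{}_{-\infty}D_{x_k}^{\nu_k}\,g=\frac{\partial^{m_1+\dots+m_k}}{\partial x_1^{m_1}\cdots\partial x_k^{m_k}}\;{}_{-\infty}I_{x_1}^{m_1-\nu_1}\cdots{}_{-\infty}I_{x_k}^{m_k-\nu_k}\,g,$$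 where ${}_{-\infty}I_x^{0}f=f$ and ${}_{-\infty}I_x^{\mu}f(x)=\frac1{\Gamma(\mu)}\int_{-\infty}^x(x-\tau)^{\mu-1}f(\tau)\,d\tau$ for $\mu>0$. Thus for $-1<\nu_i<0$ the operator in $x_i$ is the fractional integral of order $-\nu_i$. Then for every $t>0$ all successive integrals and partial derivatives in ${}_{-\infty}D_{x_1}^{\alpha_1-1}\cdots{}_{-\infty}D_{x_k}^{\alpha_k-1}e[x_1,\dots,x_k]$ exist (the integrals absolutely convergent, the derivatives continuous in the variable of differentiation) at every point of $\mathbb R^k$, the function $$f_Y(t)=\left(\prod_{i=1}^k\frac{\beta_i^{\alpha_i}}{\Gamma(\alpha_i)}\right)\;{}_{-\infty}D_{-\beta_1}^{\alpha_1-1}\cdots{}_{-\infty}D_{-\beta_k}^{\alpha_k-1}\,e[-\beta_1,\dots,-\beta_k]\qquad(t>0)$$ (the mixed derivative evaluated at $x_i=-\beta_i$) is measurable and non-negative, and, extended by $f_Y(t)=0$ for $t\le 0$, it is a probability density, with respect to Lebesgue measure, of $Y=Z_1+\dots+Z_k$. -/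

import Mathlib

open MeasureTheory ProbabilityTheory Set Filter Topology

noncomputable section

/-- The divided difference `f[x₀, …, xₙ]` at pairwise distinct nodes, by the recurrence
`f[x₀, …, xₙ] = (f[x₁, …, xₙ] - f[x₀, …, xₙ₋₁]) / (xₙ - x₀)`, `f[x₀] = f x₀`. -/
def divDiffRec (f : ℝ → ℝ) : (n : ℕ) → (Fin (n + 1) → ℝ) → ℝ
  | 0, x => f (x 0)
  | n + 1, x =>
      (divDiffRec f n (fun i => x i.succ) - divDiffRec f n (fun i => x i.castSucc)) /
        (x (Fin.last (n + 1)) - x 0)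

open Classical in
/-- The divided difference at arbitrary nodes: the recurrence when the nodes are pairwise
distinct, and its continuous extension (the limit along tuples of pairwise distinct nodes)
when some of them coincide. -/
def divDiff (f : ℝ → ℝ) {n : ℕ} (x : Fin (n + 1) → ℝ) : ℝ :=
  if Function.Injective x then divDiffRec f n x
  else extendFrom {y : Fin (n + 1) → ℝ | Function.Injective y} (divDiffRec f n) x

/-- The Liouville fractional integral of order `μ ≥ 0` (lower terminal `-∞`); order `0` is the
identity. -/
def liouvilleIntegral (μ : ℝ) (f : ℝ → ℝ) (x : ℝ) : ℝ :=
  if μ = 0 then f x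
  else (1 / Real.Gamma μ) * ∫ τ in Iio x, (x - τ) ^ (μ - 1) * f τ

/-- The integral defining `liouvilleIntegral μ f x` converges absolutely. -/
def LiouvilleIntegrable (μ : ℝ) (f : ℝ → ℝ) (x : ℝ) : Prop :=
  μ = 0 ∨ IntegrableOn (fun τ => (x - τ) ^ (μ - 1) * f τ) (Iio x)

/-- The function of the `i`-th coordinate alone, the other coordinates being those of `x`. -/
def coordSlice {k : ℕ} (g : (Fin k → ℝ) → ℝ) (i : Fin k) (x : Fin k → ℝ) : ℝ → ℝ :=
  fun τ => g (Function.update x i τ)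

/-- Liouville integrals of order `μ i` in the coordinates listed; the first coordinate of the
list is the outermost integration. -/
def iterLiouvilleIntegral {k : ℕ} (μ : Fin k → ℝ) (g : (Fin k → ℝ) → ℝ) :
    List (Fin k) → (Fin k → ℝ) → ℝ
  | [] => g
  | i :: l => fun x => liouvilleIntegral (μ i) (coordSlice (iterLiouvilleIntegral μ g l) i x) (x i)

/-- Each of the successive integrals in `iterLiouvilleIntegral` converges absolutely, at every
point. -/
def IterLiouvilleIntegrable {k : ℕ} (μ : Fin k → ℝ) (g : (Fin k → ℝ) → ℝ) :
    List (Fin k) → Prop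
  | [] => True
  | i :: l => IterLiouvilleIntegrable μ g l ∧
      ∀ x, LiouvilleIntegrable (μ i) (coordSlice (iterLiouvilleIntegral μ g l) i x) (x i)

/-- Partial derivatives of order `m i` in the coordinates listed; the first coordinate of the
list is the last to be differentiated. -/
def iterPartialDeriv {k : ℕ} (m : Fin k → ℕ) (g : (Fin k → ℝ) → ℝ) :
    List (Fin k) → (Fin k → ℝ) → ℝ
  | [] => g
  | i :: l => fun x => iteratedDeriv (m i) (coordSlice (iterPartialDeriv m g l) i x) (x i)

/-- Each of the successive partial derivatives in `iterPartialDeriv` exists, at every point, and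
is continuous in the variable of differentiation. -/
def IterPartialDifferentiable {k : ℕ} (m : Fin k → ℕ) (g : (Fin k → ℝ) → ℝ) :
    List (Fin k) → Prop
  | [] => True
  | i :: l => IterPartialDifferentiable m g l ∧
      ∀ x, ContDiff ℝ (m i) (coordSlice (iterPartialDeriv m g l) i x)

/-- The least natural number `m ≥ ν i`; it is `0` for a negative order. -/
def liouvilleDegree {k : ℕ} (ν : Fin k → ℝ) (i : Fin k) : ℕ := ⌈ν i⌉₊

/-- The mixed Liouville integral of orders `m i - ν i`, with `m i = liouvilleDegree ν i`. -/
def mixedLiouvilleIntegral {k : ℕ} (ν : Fin k → ℝ) (g : (Fin k → ℝ) → ℝ) : (Fin k → ℝ) → ℝ :=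
  iterLiouvilleIntegral (fun i => (liouvilleDegree ν i : ℝ) - ν i) g (List.finRange k)

/-- The mixed Liouville fractional derivative of order `ν i` in the `i`-th coordinate (lower
terminals `-∞`): the mixed integral of orders `m i - ν i` followed by the mixed partial derivative
of orders `m i`, where `m i = liouvilleDegree ν i`. In a coordinate with `ν i < 0` this is the
fractional integral of order `-ν i`, and for `ν i` a natural number it is the ordinary derivative.
-/
def mixedLiouvilleDeriv {k : ℕ} (ν : Fin k → ℝ) (g : (Fin k → ℝ) → ℝ) : (Fin k → ℝ) → ℝ :=
  iterPartialDeriv (liouvilleDegree ν) (mixedLiouvilleIntegral ν g) (List.finRange k)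

/-- All the integrals and derivatives in `mixedLiouvilleDeriv ν g` exist. -/
def MixedLiouvilleDifferentiable {k : ℕ} (ν : Fin k → ℝ) (g : (Fin k → ℝ) → ℝ) : Prop :=
  IterLiouvilleIntegrable (fun i => (liouvilleDegree ν i : ℝ) - ν i) g (List.finRange k) ∧
    IterPartialDifferentiable (liouvilleDegree ν) (mixedLiouvilleIntegral ν g) (List.finRange k)

/-- The function `(x₀, …, xₙ) ↦ e[x₀, …, xₙ]`, where `e(x) = exp (x * t)`. -/
def expDivDiff (n : ℕ) (t : ℝ) (x : Fin (n + 1) → ℝ) : ℝ :=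
  divDiff (fun y => Real.exp (y * t)) x

/-- `∏ βᵢ ^ αᵢ / Γ(αᵢ)` times the mixed Liouville derivative of orders `αᵢ - 1` of
`e[x₀, …, xₙ]`, evaluated at `xᵢ = -βᵢ`. -/
def gammaSumDensity {n : ℕ} (α β : Fin (n + 1) → ℝ) (t : ℝ) : ℝ :=
  (∏ i, β i ^ α i / Real.Gamma (α i)) *
    mixedLiouvilleDeriv (fun i => α i - 1) (expDivDiff n t) (fun i => -β i)

end

/-!
For `0 < t` let `σ` be Lebesgue measure on the simplex `{s | 0 < s i, ∑ s i = t}`. The divided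
difference `e[x₀, …, xₙ]` of `exp (y * t)` is `∫ exp (∑ s i * x i) ∂σ` (the Hermite–Genocchi
formula, `expDivDiff_eq_simplexIntegral`). For pairwise distinct nodes this satisfies the
recurrence of the divided differences, by integrating along the segments of the simplex on which
only the first and the last coordinate vary (`sub_mul_simplexIntegral`); the right-hand side is
continuous in `x`, and tuples of distinct nodes are dense, which settles coinciding nodes.

A Liouville integral of order `μ` takes `x ↦ exp (s * x)` to `s ^ (-μ) * exp (s * x)`, and `m`
derivatives take it to `s ^ m * exp (s * x)`. Fubini and differentiation under the integral sign
carry both operations over to the simplex integral. Hence the mixed Liouville derivative of orders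
`ν i` is `∫ ∏ s i ^ ν i * exp (s i * x i) ∂σ` (`mixedLiouville_expDivDiff`). All the integrals
converge as long as the exponents exceed `-1` (`integrable_gammaWeight`, the Dirichlet integral).
In one variable at a time these are statements about the moment generating function of a
coordinate `s i` under a finite measure on the simplex, so that smoothness and the formula for the
derivatives come from the general theory of such functions.

For `ν i = α i - 1` and `x i = -β i`, the integrand times `∏ β i ^ α i / Γ(α i)` is the joint
density of the independent gamma variables, and its integral over the simplex `∑ s i = t` is the
density of their sum at `t`: the positive orthant is foliated by these simplices
(`lintegral_lintegral_simplexMeasure`, `map_sum_pi_gammaMeasure`).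
-/

noncomputable section

/-! ### Tuples, products and Lebesgue measure -/

lemma measurePreserving_cons (n : ℕ) :
    MeasurePreserving (fun p : ℝ × (Fin n → ℝ) => (Fin.cons p.1 p.2 : Fin (n + 1) → ℝ)) := by
  have h := (volume_preserving_piFinSuccAbove (fun _ : Fin (n + 1) => ℝ) 0).symm
  refine (congrArg (fun f => MeasurePreserving f volume volume) ?_).mp h
  funext p
  exact Fin.insertNth_zero' p.1 p.2

lemma measurePreserving_snoc (n : ℕ) :
    MeasurePreserving (fun p : ℝ × (Fin n → ℝ) => (Fin.snoc p.2 p.1 : Fin (n + 1) → ℝ)) := by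
  have h := (volume_preserving_piFinSuccAbove (fun _ : Fin (n + 1) => ℝ) (Fin.last n)).symm
  refine (congrArg (fun f => MeasurePreserving f volume volume) ?_).mp h
  funext p
  exact Fin.insertNth_last' p.1 p.2

lemma measurableEmbedding_snoc (n : ℕ) :
    MeasurableEmbedding (fun p : ℝ × (Fin n → ℝ) => (Fin.snoc p.2 p.1 : Fin (n + 1) → ℝ)) := by
  have h := (MeasurableEquiv.piFinSuccAbove (fun _ : Fin (n + 1) => ℝ)
    (Fin.last n)).symm.measurableEmbedding
  refine (congrArg (fun f => MeasurableEmbedding f) ?_).mp h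
  funext p
  exact Fin.insertNth_last' p.1 p.2

lemma measurePreserving_sub_sum (n : ℕ) :
    MeasurePreserving (fun p : ℝ × (Fin n → ℝ) => (p.1 - ∑ i, p.2 i, p.2)) := by
  have h : MeasurePreserving
      (fun p : (Fin n → ℝ) × ℝ => (p.1, p.2 - ∑ i, p.1 i))
      ((volume : Measure (Fin n → ℝ)).prod (volume : Measure ℝ))
      ((volume : Measure (Fin n → ℝ)).prod (volume : Measure ℝ)) := by
    refine MeasurePreserving.skew_product (g := fun (u : Fin n → ℝ) (s : ℝ) => s - ∑ i, u i)
      (MeasurePreserving.id _) (by fun_prop) (ae_of_all _ fun u => ?_)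
    exact (measurePreserving_sub_right volume _).map_eq
  exact (Measure.measurePreserving_swap.comp h).comp Measure.measurePreserving_swap

lemma lintegral_prod_eq_prod_lintegral {n : ℕ} {f : Fin n → ℝ → ENNReal}
    (hf : ∀ i, Measurable (f i)) :
    ∫⁻ z : Fin n → ℝ, ∏ i, f i (z i) = ∏ i, ∫⁻ s, f i s := by
  induction n with
  | zero => simp [volume_pi]
  | succ n ih =>
    rw [← (measurePreserving_cons n).lintegral_comp (by fun_prop), Measure.volume_eq_prod,
      lintegral_prod _ (by
        refine (Finset.measurable_prod _ fun i _ => (hf i).comp ?_).aemeasurable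
        exact (measurable_pi_apply i).comp (measurePreserving_cons n).measurable)]
    simp only [Fin.prod_univ_succ, Fin.cons_zero, Fin.cons_succ]
    rw [← ih fun i => hf i.succ, ← lintegral_mul_const _ (hf 0)]
    refine lintegral_congr fun s => ?_
    rw [lintegral_const_mul _ (by fun_prop)]

lemma pi_withDensity_eq {n : ℕ} {f : Fin n → ℝ → ENNReal} (hf : ∀ i, Measurable (f i))
    [∀ i, SigmaFinite ((volume : Measure ℝ).withDensity (f i))] :
    Measure.pi (fun i => (volume : Measure ℝ).withDensity (f i)) =
      (volume : Measure (Fin n → ℝ)).withDensity (fun z => ∏ i, f i (z i)) := by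
  refine Measure.pi_eq fun s hs => ?_
  rw [withDensity_apply _ (MeasurableSet.univ_pi hs),
    ← lintegral_indicator (MeasurableSet.univ_pi hs)]
  have h : (fun z : Fin n → ℝ => (univ.pi s).indicator (fun z => ∏ i, f i (z i)) z) =
      fun z => ∏ i, (s i).indicator (f i) (z i) := by
    funext z
    by_cases hz : z ∈ univ.pi s
    · rw [indicator_of_mem hz]
      exact Finset.prod_congr rfl fun i _ => (indicator_of_mem (hz i (mem_univ i)) _).symm
    · rw [indicator_of_notMem hz]
      simp only [mem_univ_pi, not_forall] at hz
      obtain ⟨i, hi⟩ := hz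
      exact (Finset.prod_eq_zero (Finset.mem_univ i) (indicator_of_notMem hi _)).symm
  rw [h, lintegral_prod_eq_prod_lintegral fun i => (hf i).indicator (hs i)]
  refine Finset.prod_congr rfl fun i _ => ?_
  rw [withDensity_apply _ (hs i), lintegral_indicator (hs i)]

/-! ### Lebesgue measure on a simplex -/

/-- The open positive orthant. -/
def posOrthant (n : ℕ) : Set (Fin n → ℝ) := {s | ∀ i, 0 < s i}

lemma measurableSet_posOrthant (n : ℕ) : MeasurableSet (posOrthant n) := by
  have : posOrthant n = ⋂ i, (fun s => s i) ⁻¹' Ioi 0 := by ext; simp [posOrthant]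
  rw [this]
  exact MeasurableSet.iInter fun i => measurable_pi_apply i measurableSet_Ioi

/-- The point of the hyperplane `∑ s i = t` whose coordinates of positive index are `u`. -/
def hyperplanePoint {n : ℕ} (t : ℝ) (u : Fin n → ℝ) : Fin (n + 1) → ℝ :=
  Fin.cons (t - ∑ i, u i) u

/-- Lebesgue measure on the open simplex `{s | 0 < s i, ∑ s i = t}`, normalised so that dropping
the coordinate of index `0` carries it to Lebesgue measure on `Fin n → ℝ`. For `n = 0` and `0 < t`
it is the point mass at `t`. -/
def simplexMeasure (n : ℕ) (t : ℝ) : Measure (Fin (n + 1) → ℝ) :=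
  ((volume : Measure (Fin n → ℝ)).map (hyperplanePoint t)).restrict (posOrthant (n + 1))

lemma measurePreserving_hyperplanePoint (n : ℕ) :
    MeasurePreserving (fun p : ℝ × (Fin n → ℝ) => hyperplanePoint p.1 p.2) :=
  (measurePreserving_cons n).comp (measurePreserving_sub_sum n)

lemma measurable_hyperplanePoint {n : ℕ} (t : ℝ) :
    Measurable (hyperplanePoint t : (Fin n → ℝ) → _) :=
  (measurePreserving_hyperplanePoint n).measurable.comp (measurable_const.prodMk measurable_id)

lemma sum_hyperplanePoint {n : ℕ} (t : ℝ) (u : Fin n → ℝ) : ∑ i, hyperplanePoint t u i = t := by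
  simp [hyperplanePoint, Fin.sum_univ_succ]

lemma lintegral_simplexMeasure {n : ℕ} {t : ℝ} {f : (Fin (n + 1) → ℝ) → ENNReal}
    (hf : Measurable f) : ∫⁻ s, f s ∂simplexMeasure n t =
      ∫⁻ u, (posOrthant (n + 1)).indicator f (hyperplanePoint t u) := by
  rw [simplexMeasure, ← lintegral_indicator (measurableSet_posOrthant _),
    lintegral_map (hf.indicator (measurableSet_posOrthant _)) (measurable_hyperplanePoint t)]

lemma ae_simplexMeasure_pos (n : ℕ) (t : ℝ) : ∀ᵐ s ∂simplexMeasure n t, ∀ i, 0 < s i :=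
  ae_restrict_mem (measurableSet_posOrthant _)

lemma ae_simplexMeasure_sum (n : ℕ) (t : ℝ) : ∀ᵐ s ∂simplexMeasure n t, ∑ i, s i = t := by
  refine ae_restrict_of_ae ?_
  rw [ae_map_iff (measurable_hyperplanePoint t).aemeasurable
    (measurableSet_eq_fun (by fun_prop) measurable_const)]
  exact ae_of_all _ fun u => sum_hyperplanePoint t u

lemma ae_simplexMeasure_le (n : ℕ) (t : ℝ) : ∀ᵐ s ∂simplexMeasure n t, ∀ i, s i ≤ t := by
  filter_upwards [ae_simplexMeasure_pos n t, ae_simplexMeasure_sum n t] with s hs hst i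
  rw [← hst]
  exact Finset.single_le_sum (fun j _ => (hs j).le) (Finset.mem_univ i)

lemma measurable_lintegral_simplexMeasure {n : ℕ} {f : (Fin (n + 1) → ℝ) → ENNReal}
    (hf : Measurable f) : Measurable fun t => ∫⁻ s, f s ∂simplexMeasure n t := by
  simp only [lintegral_simplexMeasure hf]
  exact ((hf.indicator (measurableSet_posOrthant _)).comp
    (measurePreserving_hyperplanePoint n).measurable).lintegral_prod_right'

/-- The simplices `∑ s i = t` foliate the positive orthant: this is Tonelli's theorem for the
volume-preserving change of variables `(t, u) ↦ (t - ∑ u, u)`. -/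
lemma lintegral_lintegral_simplexMeasure {n : ℕ} {f : (Fin (n + 1) → ℝ) → ENNReal}
    (hf : Measurable f) {φ : ℝ → ENNReal} (hφ : Measurable φ) :
    ∫⁻ t, φ t * ∫⁻ s, f s ∂simplexMeasure n t =
      ∫⁻ z, φ (∑ i, z i) * (posOrthant (n + 1)).indicator f z := by
  have hm := hf.indicator (measurableSet_posOrthant (n + 1))
  have hmp := measurePreserving_hyperplanePoint n
  have hg : Measurable fun z : Fin (n + 1) → ℝ =>
      φ (∑ i, z i) * (posOrthant (n + 1)).indicator f z := by fun_prop
  rw [← hmp.lintegral_comp hg, Measure.volume_eq_prod,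
    lintegral_prod (fun p : ℝ × (Fin n → ℝ) => φ (∑ i, hyperplanePoint p.1 p.2 i) *
      (posOrthant (n + 1)).indicator f (hyperplanePoint p.1 p.2))
      (hg.comp hmp.measurable).aemeasurable]
  refine lintegral_congr fun t => ?_
  simp only [sum_hyperplanePoint]
  rw [lintegral_simplexMeasure hf]
  exact (lintegral_const_mul _ (hm.comp (measurable_hyperplanePoint t))).symm

/-! ### Gamma weights on a simplex -/

/-- The weight `∏ s i ^ a i * exp (s i * x i)`, the product of the unnormalised gamma densities
of shapes `a i + 1` and rates `-x i`. -/
def gammaWeight {k : ℕ} (a x s : Fin k → ℝ) : ℝ := ∏ i, s i ^ a i * Real.exp (s i * x i)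

@[fun_prop]
lemma measurable_gammaWeight {k : ℕ} (a x : Fin k → ℝ) : Measurable (gammaWeight a x) := by
  unfold gammaWeight; fun_prop

lemma gammaWeight_pos {k : ℕ} (a x : Fin k → ℝ) {s : Fin k → ℝ} (hs : s ∈ posOrthant k) :
    0 < gammaWeight a x s :=
  Finset.prod_pos fun i _ => mul_pos (Real.rpow_pos_of_pos (hs i) _) (Real.exp_pos _)

lemma indicator_ofReal_gammaWeight {k : ℕ} (a x s : Fin k → ℝ) :
    (posOrthant k).indicator (fun s => ENNReal.ofReal (gammaWeight a x s)) s =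
      ∏ i, (Ioi (0 : ℝ)).indicator
        (fun v => ENNReal.ofReal (v ^ a i * Real.exp (v * x i))) (s i) := by
  by_cases hs : s ∈ posOrthant k
  · rw [indicator_of_mem hs, gammaWeight, ENNReal.ofReal_prod_of_nonneg fun i _ =>
      (mul_pos (Real.rpow_pos_of_pos (hs i) _) (Real.exp_pos _)).le]
    refine Finset.prod_congr rfl fun i _ => ?_
    rw [indicator_of_mem (mem_Ioi.2 (hs i))]
  · rw [indicator_of_notMem hs]
    obtain ⟨i, hi⟩ : ∃ i, ¬ 0 < s i := not_forall.1 hs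
    refine (Finset.prod_eq_zero (Finset.mem_univ i) ?_).symm
    rw [indicator_of_notMem (mt mem_Ioi.1 hi)]

lemma lintegral_lintegral_gammaWeight_lt_top {n : ℕ} {a : Fin (n + 1) → ℝ} (ha : ∀ i, -1 < a i) :
    ∫⁻ t, ∫⁻ s, ENNReal.ofReal (gammaWeight a (fun _ => -1) s) ∂simplexMeasure n t < ⊤ := by
  have h := lintegral_lintegral_simplexMeasure (n := n)
    (f := fun s => ENNReal.ofReal (gammaWeight a (fun _ => -1) s)) (by fun_prop)
    (φ := fun _ => 1) measurable_const
  simp only [one_mul, indicator_ofReal_gammaWeight] at h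
  rw [h, lintegral_prod_eq_prod_lintegral
    (f := fun i => (Ioi (0 : ℝ)).indicator fun v => ENNReal.ofReal (v ^ a i * Real.exp (v * -1)))
    (fun i => Measurable.indicator (by fun_prop) measurableSet_Ioi)]
  refine ENNReal.prod_lt_top fun i _ => ?_
  rw [lintegral_indicator measurableSet_Ioi]
  have hint := Real.GammaIntegral_convergent (s := a i + 1) (by linarith [ha i])
  refine lt_of_le_of_lt (le_of_eq ?_) hint.2.lt_top
  refine setLIntegral_congr_fun measurableSet_Ioi fun v hv => ?_
  have hv' : (0 : ℝ) < v := hv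
  rw [Real.enorm_eq_ofReal (by positivity)]
  congr 1
  rw [mul_comm]; congr 2 <;> ring

lemma gammaWeight_smul_le {k : ℕ} (a x : Fin k → ℝ) {c t : ℝ} (hc : 0 < c) {s : Fin k → ℝ}
    (hs : s ∈ posOrthant k) (hst : ∀ i, s i ≤ t) :
    gammaWeight a x (c • s) ≤
      (∏ i, c ^ a i * Real.exp (t * |c * x i + 1|)) * gammaWeight a (fun _ => -1) s := by
  rw [gammaWeight, gammaWeight, ← Finset.prod_mul_distrib]
  refine Finset.prod_le_prod (fun i _ => ?_) fun i _ => ?_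
  · have := hs i
    simp only [Pi.smul_apply, smul_eq_mul]
    positivity
  · have hi := hs i
    have h1 : s i * (c * x i + 1) ≤ t * |c * x i + 1| :=
      (mul_le_mul_of_nonneg_left (le_abs_self _) hi.le).trans
        (mul_le_mul_of_nonneg_right (hst i) (abs_nonneg _))
    have h2 : Real.exp (c * s i * x i) = Real.exp (s i * (c * x i + 1)) * Real.exp (s i * -1) := by
      rw [← Real.exp_add]; ring_nf
    simp only [Pi.smul_apply, smul_eq_mul]
    rw [Real.mul_rpow hc.le hi.le, h2]
    calc c ^ a i * s i ^ a i * (Real.exp (s i * (c * x i + 1)) * Real.exp (s i * -1))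
        = c ^ a i * Real.exp (s i * (c * x i + 1)) * (s i ^ a i * Real.exp (s i * -1)) := by ring
      _ ≤ c ^ a i * Real.exp (t * |c * x i + 1|) * (s i ^ a i * Real.exp (s i * -1)) := by
        gcongr

lemma lintegral_lt_top_of_comp_smul {n : ℕ} {g : (Fin n → ℝ) → ENNReal} (hg : Measurable g)
    {c : ℝ} (hc : 0 < c) (h : ∫⁻ u, g (c • u) < ⊤) : ∫⁻ u, g u < ⊤ := by
  rw [← lintegral_map hg (measurable_const_smul c),
    Measure.map_addHaar_smul volume hc.ne', lintegral_smul_measure, smul_eq_mul] at h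
  refine ENNReal.lt_top_of_mul_ne_top_right h.ne ?_
  simp only [ne_eq, ENNReal.ofReal_eq_zero, not_le]
  positivity

lemma hyperplanePoint_smul {n : ℕ} (c t : ℝ) (u : Fin n → ℝ) :
    hyperplanePoint (c * t) (c • u) = c • hyperplanePoint t u := by
  funext i
  refine Fin.cases ?_ (fun j => ?_) i
  · simp [hyperplanePoint, mul_sub, Finset.mul_sum]
  · simp [hyperplanePoint]

/-- The Dirichlet integral converges. By Tonelli it is the density at `t` of a finite measure,
so it is finite for almost every `t`; homogeneity in `t` carries this over to every `0 < t`. -/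
lemma integrable_gammaWeight {n : ℕ} {a : Fin (n + 1) → ℝ} (ha : ∀ i, -1 < a i)
    (x : Fin (n + 1) → ℝ) {t : ℝ} (ht : 0 < t) :
    Integrable (gammaWeight a x) (simplexMeasure n t) := by
  refine ⟨(measurable_gammaWeight a x).aestronglyMeasurable, ?_⟩
  rw [hasFiniteIntegral_iff_ofReal ((ae_simplexMeasure_pos n t).mono fun s hs =>
    (gammaWeight_pos a x hs).le)]
  have hae : ∀ᵐ t₀ ∂(volume.restrict (Ioi (0 : ℝ))), t₀ ∈ Ioi (0 : ℝ) ∧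
      ∫⁻ s, ENNReal.ofReal (gammaWeight a (fun _ => -1) s) ∂simplexMeasure n t₀ < ⊤ :=
    (ae_restrict_mem measurableSet_Ioi).and (ae_restrict_of_ae
      (ae_lt_top (measurable_lintegral_simplexMeasure (by fun_prop))
        (lintegral_lintegral_gammaWeight_lt_top ha).ne))
  have : (ae (volume.restrict (Ioi (0 : ℝ)))).NeBot := by
    rw [ae_neBot]; simp [Measure.restrict_eq_zero]
  obtain ⟨t₀, ht₀, hfin⟩ := hae.exists
  have ht₀' : 0 < t₀ := ht₀
  have hc : 0 < t / t₀ := div_pos ht ht₀'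
  have hmeas : ∀ y, Measurable fun s : Fin (n + 1) → ℝ => ENNReal.ofReal (gammaWeight a y s) :=
    fun y => by fun_prop
  have hind : ∀ y, Measurable ((posOrthant (n + 1)).indicator
      fun s : Fin (n + 1) → ℝ => ENNReal.ofReal (gammaWeight a y s)) :=
    fun y => (hmeas y).indicator (measurableSet_posOrthant _)
  rw [lintegral_simplexMeasure (hmeas x)]
  refine lintegral_lt_top_of_comp_smul
    ((hind x).comp (measurable_hyperplanePoint t)) hc ?_
  rw [lintegral_simplexMeasure (hmeas _)] at hfin
  set K := ENNReal.ofReal (∏ i, (t / t₀) ^ a i * Real.exp (t₀ * |t / t₀ * x i + 1|)) with hK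
  refine lt_of_le_of_lt (lintegral_mono (g := fun u => K * (posOrthant (n + 1)).indicator
    (fun s => ENNReal.ofReal (gammaWeight a (fun _ => -1) s)) (hyperplanePoint t₀ u))
    fun u => ?_) ?_
  · have heq : hyperplanePoint t ((t / t₀) • u) = (t / t₀) • hyperplanePoint t₀ u := by
      rw [← hyperplanePoint_smul, div_mul_cancel₀ _ ht₀'.ne']
    simp only [heq]
    set s := hyperplanePoint t₀ u with hs
    by_cases hpos : s ∈ posOrthant (n + 1)
    · have hpos' : (t / t₀) • s ∈ posOrthant (n + 1) := fun i => mul_pos hc (hpos i)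
      rw [indicator_of_mem hpos, indicator_of_mem hpos', hK,
        ← ENNReal.ofReal_mul (by positivity)]
      refine ENNReal.ofReal_le_ofReal (gammaWeight_smul_le a x hc hpos fun i => ?_)
      rw [← sum_hyperplanePoint t₀ u]
      exact Finset.single_le_sum (f := s) (fun j _ => (hpos j).le) (Finset.mem_univ i)
    · have hpos' : (t / t₀) • s ∉ posOrthant (n + 1) := fun h =>
        hpos fun i => pos_of_mul_pos_right (h i) hc.le
      rw [indicator_of_notMem hpos']
      exact zero_le
  · refine lt_of_eq_of_lt
      (lintegral_const_mul _ ((hind _).comp (measurable_hyperplanePoint t₀))) ?_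
    exact ENNReal.mul_lt_top ENNReal.ofReal_lt_top hfin

/-- The Dirichlet-type integral `∫ ∏ s i ^ a i * exp (s i * x i)` over the simplex
`{s | 0 < s i, ∑ s i = t}`. -/
def simplexIntegral {n : ℕ} (t : ℝ) (a x : Fin (n + 1) → ℝ) : ℝ :=
  ∫ s, gammaWeight a x s ∂simplexMeasure n t

lemma simplexIntegral_nonneg {n : ℕ} (t : ℝ) (a x : Fin (n + 1) → ℝ) :
    0 ≤ simplexIntegral t a x :=
  integral_nonneg_of_ae ((ae_simplexMeasure_pos n t).mono fun _ hs => (gammaWeight_pos a x hs).le)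

/-! ### Divided differences of the exponential function -/

/-- On the simplex the dependent coordinate may be taken to be the last one instead of the
first one. -/
lemma map_snoc_eq_map_hyperplanePoint (n : ℕ) (t : ℝ) :
    (volume : Measure (Fin n → ℝ)).map
        (fun u => (Fin.snoc u (t - ∑ i, u i) : Fin (n + 1) → ℝ)) =
      (volume : Measure (Fin n → ℝ)).map (hyperplanePoint t) := by
  cases n with
  | zero =>
    congr 1
    funext u i
    obtain rfl : i = Fin.last 0 := Fin.ext (by lia)
    rw [Fin.snoc_last]
    simp [hyperplanePoint]
  | succ n =>
    have hT : MeasurePreserving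
        (fun p : ℝ × (Fin n → ℝ) => (Fin.cons (t - p.1 - ∑ i, p.2 i) p.2 : Fin (n + 1) → ℝ)) :=
      ((measurePreserving_cons n).comp (measurePreserving_sub_sum n)).comp
        ((Measure.measurePreserving_sub_left volume t).prod (MeasurePreserving.id volume))
    have hS := measurePreserving_snoc n
    have hm : Measurable
        (fun u : Fin (n + 1) → ℝ => (Fin.snoc u (t - ∑ i, u i) : Fin (n + 2) → ℝ)) :=
      (measurePreserving_snoc (n + 1)).measurable.comp
        (f := fun u : Fin (n + 1) → ℝ => (t - ∑ i, u i, u)) (by fun_prop)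
    conv_lhs => rw [← hT.map_eq]
    conv_rhs => rw [← hS.map_eq]
    rw [Measure.map_map hm hT.measurable,
      Measure.map_map (measurable_hyperplanePoint t) hS.measurable]
    congr 1
    funext p
    simp only [Function.comp_apply, hyperplanePoint, Fin.sum_cons, Fin.sum_snoc]
    rw [Fin.cons_snoc_eq_snoc_cons]
    congr 1 <;> [congr 1; skip] <;> ring

lemma integral_simplexMeasure {n : ℕ} {t : ℝ} {f : (Fin (n + 1) → ℝ) → ℝ}
    (hf : Measurable f) : ∫ s, f s ∂simplexMeasure n t =
      ∫ u, (posOrthant (n + 1)).indicator f (hyperplanePoint t u) := by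
  rw [simplexMeasure, ← integral_indicator (measurableSet_posOrthant _),
    integral_map (measurable_hyperplanePoint t).aemeasurable
      (hf.indicator (measurableSet_posOrthant _)).aestronglyMeasurable]

lemma integral_simplexMeasure_snoc {n : ℕ} {t : ℝ} {f : (Fin (n + 1) → ℝ) → ℝ}
    (hf : Measurable f) : ∫ s, f s ∂simplexMeasure n t =
      ∫ u : Fin n → ℝ, (posOrthant (n + 1)).indicator f (Fin.snoc u (t - ∑ i, u i)) := by
  have hm : Measurable (fun u : Fin n → ℝ => (Fin.snoc u (t - ∑ i, u i) : Fin (n + 1) → ℝ)) :=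
    (measurePreserving_snoc n).measurable.comp
      (f := fun u : Fin n → ℝ => (t - ∑ i, u i, u)) (by fun_prop)
  rw [simplexMeasure, ← integral_indicator (measurableSet_posOrthant _),
    ← map_snoc_eq_map_hyperplanePoint,
    integral_map hm.aemeasurable (hf.indicator (measurableSet_posOrthant _)).aestronglyMeasurable]

lemma integrable_simplexMeasure_iff {n : ℕ} {t : ℝ} {f : (Fin (n + 1) → ℝ) → ℝ}
    (hf : Measurable f) : Integrable f (simplexMeasure n t) ↔
      Integrable fun u => (posOrthant (n + 1)).indicator f (hyperplanePoint t u) := by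
  rw [simplexMeasure, ← IntegrableOn, ← integrable_indicator_iff (measurableSet_posOrthant _),
    integrable_map_measure (hf.indicator (measurableSet_posOrthant _)).aestronglyMeasurable
      (measurable_hyperplanePoint t).aemeasurable]
  rfl

lemma integrable_simplexMeasure_iff_snoc {n : ℕ} {t : ℝ} {f : (Fin (n + 1) → ℝ) → ℝ}
    (hf : Measurable f) : Integrable f (simplexMeasure n t) ↔
      Integrable fun u : Fin n → ℝ =>
        (posOrthant (n + 1)).indicator f (Fin.snoc u (t - ∑ i, u i)) := by
  have hm : Measurable (fun u : Fin n → ℝ => (Fin.snoc u (t - ∑ i, u i) : Fin (n + 1) → ℝ)) :=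
    (measurePreserving_snoc n).measurable.comp
      (f := fun u : Fin n → ℝ => (t - ∑ i, u i, u)) (by fun_prop)
  rw [simplexMeasure, ← IntegrableOn, ← integrable_indicator_iff (measurableSet_posOrthant _),
    ← map_snoc_eq_map_hyperplanePoint,
    integrable_map_measure (hf.indicator (measurableSet_posOrthant _)).aestronglyMeasurable
      hm.aemeasurable]
  rfl

lemma gammaWeight_zero {k : ℕ} (x s : Fin k → ℝ) :
    gammaWeight 0 x s = Real.exp (∑ i, s i * x i) := by
  simp [gammaWeight, Real.exp_sum]

lemma cons_mem_posOrthant {n : ℕ} {c : ℝ} {w : Fin n → ℝ} :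
    (Fin.cons c w : Fin (n + 1) → ℝ) ∈ posOrthant (n + 1) ↔ 0 < c ∧ w ∈ posOrthant n := by
  change (∀ i, _) ↔ _ ∧ ∀ i, _
  simp [Fin.forall_fin_succ]

lemma snoc_mem_posOrthant {n : ℕ} {c : ℝ} {w : Fin n → ℝ} :
    (Fin.snoc w c : Fin (n + 1) → ℝ) ∈ posOrthant (n + 1) ↔ w ∈ posOrthant n ∧ 0 < c := by
  change (∀ i, _) ↔ (∀ i, _) ∧ _
  simp [Fin.forall_fin_succ']

lemma sub_mul_intervalIntegral_exp (p q b c : ℝ) :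
    (q - p) * ∫ v in (0 : ℝ)..c, Real.exp ((c - v) * p + v * q + b) =
      Real.exp (c * q + b) - Real.exp (c * p + b) := by
  rw [← intervalIntegral.integral_const_mul]
  rw [intervalIntegral.integral_eq_sub_of_hasDerivAt
    (f := fun v => Real.exp ((c - v) * p + v * q + b)) (fun v _ => ?_)
    (Continuous.intervalIntegrable (by fun_prop) _ _)]
  · simp
  · have h : HasDerivAt (fun v : ℝ => (c - v) * p + v * q + b) (q - p) v := by
      have h1 := (((hasDerivAt_id v).const_sub c).mul_const p).add ((hasDerivAt_id v).mul_const q)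
      refine (h1.add_const b).congr_deriv ?_
      ring
    simpa [mul_comm] using h.exp

/-- Integration along one segment of the simplex: the step from `n + 1` nodes to `n`. -/
lemma sub_mul_integral_segment {n : ℕ} (x : Fin (n + 2) → ℝ) (w : Fin n → ℝ) (c : ℝ) :
    (x (Fin.last (n + 1)) - x 0) * ∫ v : ℝ, (posOrthant (n + 2)).indicator (gammaWeight 0 x)
        (Fin.cons (c - v) (Fin.snoc w v : Fin (n + 1) → ℝ)) =
      (posOrthant (n + 1)).indicator (gammaWeight 0 fun i => x i.succ) (Fin.snoc w c) -
        (posOrthant (n + 1)).indicator (gammaWeight 0 fun i => x i.castSucc) (Fin.cons c w) := by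
  by_cases h : w ∈ posOrthant n ∧ 0 < c
  · rw [indicator_of_mem (snoc_mem_posOrthant.2 h), indicator_of_mem (cons_mem_posOrthant.2 h.symm)]
    set b := ∑ i, w i * x i.castSucc.succ with hb
    have hind : (fun v : ℝ => (posOrthant (n + 2)).indicator (gammaWeight 0 x)
        (Fin.cons (c - v) (Fin.snoc w v : Fin (n + 1) → ℝ))) =
        (Ioo 0 c).indicator
          fun v => Real.exp ((c - v) * x 0 + v * x (Fin.last (n + 1)) + b) := by
      funext v
      by_cases hv : v ∈ Ioo 0 c
      · rw [indicator_of_mem hv, indicator_of_mem (cons_mem_posOrthant.2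
          ⟨sub_pos.2 hv.2, snoc_mem_posOrthant.2 ⟨h.1, hv.1⟩⟩), gammaWeight_zero,
          Fin.sum_univ_succ, Fin.sum_univ_castSucc]
        simp only [Fin.cons_zero, Fin.cons_succ, Fin.snoc_castSucc, ← Fin.succ_last, Fin.snoc_last,
          hb]
        congr 1
        ring
      · rw [indicator_of_notMem hv, indicator_of_notMem]
        rw [cons_mem_posOrthant, snoc_mem_posOrthant, sub_pos]
        exact fun hh => hv ⟨hh.2.2, hh.1⟩
    rw [hind, integral_indicator measurableSet_Ioo, ← integral_Ioc_eq_integral_Ioo,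
      ← intervalIntegral.integral_of_le h.2.le, sub_mul_intervalIntegral_exp]
    congr 1
    · rw [gammaWeight_zero, Fin.sum_univ_castSucc]
      simp only [Fin.snoc_castSucc, Fin.snoc_last, Fin.succ_last, hb]
      rw [add_comm]
    · rw [gammaWeight_zero, Fin.sum_univ_succ]
      simp only [Fin.cons_zero, Fin.cons_succ, Fin.castSucc_zero, hb, Fin.succ_castSucc]
  · rw [indicator_of_notMem (mt snoc_mem_posOrthant.1 h),
      indicator_of_notMem (mt cons_mem_posOrthant.1 (mt And.symm h)), sub_zero]
    refine mul_eq_zero_of_right _ (integral_eq_zero_of_ae (ae_of_all _ fun v => ?_))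
    refine indicator_of_notMem (fun hv => h ?_) _
    rw [cons_mem_posOrthant, snoc_mem_posOrthant] at hv
    exact ⟨hv.2.1, by linarith [hv.1, hv.2.2]⟩

lemma sub_mul_simplexIntegral {n : ℕ} {t : ℝ} (ht : 0 < t) (x : Fin (n + 2) → ℝ) :
    (x (Fin.last (n + 1)) - x 0) * simplexIntegral t 0 x =
      simplexIntegral t 0 (fun i : Fin (n + 1) => x i.succ) -
        simplexIntegral t 0 (fun i : Fin (n + 1) => x i.castSucc) := by
  have hint : ∀ {m : ℕ} (y : Fin (m + 1) → ℝ), Integrable (gammaWeight 0 y) (simplexMeasure m t) :=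
    fun y => integrable_gammaWeight (fun _ => by simp) y ht
  have hmp := measurePreserving_snoc n
  have hemb := measurableEmbedding_snoc n
  have h2 : Integrable (fun p : ℝ × (Fin n → ℝ) => (posOrthant (n + 2)).indicator
      (gammaWeight 0 x) (hyperplanePoint t (Fin.snoc p.2 p.1 : Fin (n + 1) → ℝ))) :=
    (hmp.integrable_comp_emb hemb).2
      ((integrable_simplexMeasure_iff (measurable_gammaWeight 0 x)).1 (hint x))
  have hsum : ∀ (w : Fin n → ℝ) (v : ℝ),
      hyperplanePoint t (Fin.snoc w v : Fin (n + 1) → ℝ) =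
        Fin.cons (t - ∑ i, w i - v) (Fin.snoc w v : Fin (n + 1) → ℝ) := by
    intro w v
    rw [hyperplanePoint, Fin.sum_snoc, sub_sub]
  have h3 : simplexIntegral t 0 x = ∫ w : Fin n → ℝ, ∫ v : ℝ, (posOrthant (n + 2)).indicator
      (gammaWeight 0 x)
        (Fin.cons (t - ∑ i, w i - v) (Fin.snoc w v : Fin (n + 1) → ℝ)) := by
    rw [simplexIntegral, integral_simplexMeasure (measurable_gammaWeight 0 x),
      ← hmp.integral_comp hemb, Measure.volume_eq_prod, integral_prod_symm _ h2]
    simp only [hsum]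
  rw [h3, ← integral_const_mul]
  simp only [sub_mul_integral_segment]
  refine (integral_sub
    ((integrable_simplexMeasure_iff_snoc (measurable_gammaWeight 0 _)).1 (hint _))
    ((integrable_simplexMeasure_iff (measurable_gammaWeight 0 _)).1 (hint _))).trans ?_
  rw [simplexIntegral, simplexIntegral, integral_simplexMeasure_snoc (measurable_gammaWeight 0 _),
    integral_simplexMeasure (measurable_gammaWeight 0 _)]

lemma simplexIntegral_zero_of_subsingleton {t : ℝ} (ht : 0 < t) (x : Fin 1 → ℝ) :
    simplexIntegral t 0 x = Real.exp (x 0 * t) := by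
  have h : ∀ u : Fin 0 → ℝ, (posOrthant 1).indicator (gammaWeight 0 x) (hyperplanePoint t u) =
      Real.exp (x 0 * t) := by
    intro u
    rw [indicator_of_mem, gammaWeight_zero]
    · simp [hyperplanePoint, mul_comm]
    · rw [hyperplanePoint, cons_mem_posOrthant]
      exact ⟨by simpa using ht, fun i => i.elim0⟩
  rw [simplexIntegral, integral_simplexMeasure (measurable_gammaWeight 0 x)]
  simp [h, volume_pi, measureReal_def]

/-- The Hermite–Genocchi formula for `exp (y * t)` at pairwise distinct nodes. -/
lemma divDiffRec_exp {t : ℝ} (ht : 0 < t) {n : ℕ} {x : Fin (n + 1) → ℝ}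
    (hx : Function.Injective x) :
    divDiffRec (fun y => Real.exp (y * t)) n x = simplexIntegral t 0 x := by
  induction n with
  | zero => rw [simplexIntegral_zero_of_subsingleton ht, divDiffRec]
  | succ n ih =>
    have hne : x (Fin.last (n + 1)) - x 0 ≠ 0 :=
      sub_ne_zero.2 fun h => (Fin.last_pos (n := n)).ne' (hx h)
    have h1 := ih (hx.comp (Fin.succ_injective _))
    have h2 := ih (hx.comp (Fin.castSucc_injective _))
    simp only [Function.comp_def] at h1 h2
    rw [divDiffRec, h1, h2, div_eq_iff hne, mul_comm,
      ← sub_mul_simplexIntegral ht x]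

lemma continuous_simplexIntegral {n : ℕ} {t : ℝ} (ht : 0 < t) {a : Fin (n + 1) → ℝ}
    (ha : ∀ i, -1 < a i) : Continuous (simplexIntegral (n := n) t a) := by
  refine continuous_iff_continuousAt.2 fun x₀ => ?_
  refine continuousAt_of_dominated (bound := gammaWeight a fun _ => ‖x₀‖ + 1)
    (Eventually.of_forall fun x => (measurable_gammaWeight a x).aestronglyMeasurable)
    ?_ (integrable_gammaWeight ha _ ht) (ae_of_all _ fun s => ?_)
  · filter_upwards [Metric.ball_mem_nhds x₀ one_pos] with x hx
    filter_upwards [ae_simplexMeasure_pos n t] with s hs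
    rw [Real.norm_of_nonneg (gammaWeight_pos a x hs).le]
    refine Finset.prod_le_prod (fun i _ => ?_) fun i _ => ?_
    · have := hs i
      positivity
    · have h0 := hs i
      have h1 : x i ≤ ‖x₀‖ + 1 := by
        have h2 : ‖x - x₀‖ < 1 := by simpa [dist_eq_norm] using hx
        have h3 := norm_le_norm_add_norm_sub' x x₀
        linarith [(le_abs_self (x i)).trans (norm_le_pi_norm x i)]
      have := Real.rpow_pos_of_pos h0 (a i)
      gcongr
  · exact Continuous.continuousAt (continuous_finsetProd _ fun i _ => by fun_prop)

lemma mem_closure_injective {n : ℕ} (x : Fin n → ℝ) :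
    x ∈ closure {y : Fin n → ℝ | Function.Injective y} := by
  have hlim : Tendsto (fun (ε : ℝ) (i : Fin n) => x i + ε * (i : ℝ)) (𝓝[≠] 0) (𝓝 x) := by
    refine Tendsto.mono_left ?_ nhdsWithin_le_nhds
    have h : Continuous fun (ε : ℝ) (i : Fin n) => x i + ε * (i : ℝ) := by fun_prop
    simpa using h.tendsto 0
  -- Moving the nodes apart with speeds `i` separates each pair for all small `ε ≠ 0`.
  refine mem_closure_of_tendsto hlim ?_
  have hpair : ∀ i j : Fin n, ∀ᶠ ε in 𝓝[≠] (0 : ℝ),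
      x i + ε * (i : ℝ) = x j + ε * (j : ℝ) → i = j := by
    intro i j
    by_cases hij : x i = x j
    · filter_upwards [self_mem_nhdsWithin] with ε hε h
      rw [hij, add_right_inj] at h
      exact Fin.ext (by exact_mod_cast mul_left_cancel₀ hε h)
    · have hc : ContinuousAt (fun ε : ℝ => (x i + ε * (i : ℝ)) - (x j + ε * (j : ℝ))) 0 := by
        fun_prop
      have hne := hc.eventually_ne (y := 0) (by simpa [sub_eq_zero] using hij)
      filter_upwards [nhdsWithin_le_nhds hne] with ε hε h
      exact absurd (sub_eq_zero.2 h) hε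
  filter_upwards [eventually_all.2 fun i => eventually_all.2 (hpair i)] with ε hε i j h
  exact hε i j h

/-- The Hermite–Genocchi formula for `exp (y * t)`: the divided difference is the integral of
`exp (∑ s i * x i)` over the simplex `{s | 0 < s i, ∑ s i = t}`. -/
lemma expDivDiff_eq_simplexIntegral {n : ℕ} {t : ℝ} (ht : 0 < t) :
    expDivDiff n t = simplexIntegral t 0 := by
  funext x
  rw [expDivDiff, divDiff]
  split_ifs with hx
  · exact divDiffRec_exp ht hx
  · refine extendFrom_eq (mem_closure_injective x) ?_
    have hc := (continuous_simplexIntegral (n := n) ht (a := 0) fun _ => by simp).tendsto x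
    refine (hc.mono_left nhdsWithin_le_nhds).congr' ?_
    filter_upwards [self_mem_nhdsWithin] with y hy
    exact (divDiffRec_exp ht hy).symm

/-! ### Fractional integrals and derivatives of moment generating functions -/

lemma integrableOn_and_integral_rpow_mul_exp_Iio {μ r : ℝ} (hμ : 0 < μ) (hr : 0 < r) (y : ℝ) :
    IntegrableOn (fun τ => (y - τ) ^ (μ - 1) * Real.exp (τ * r)) (Iio y) ∧
      ∫ τ in Iio y, (y - τ) ^ (μ - 1) * Real.exp (τ * r) =
        Real.Gamma μ * (r ^ (-μ) * Real.exp (y * r)) := by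
  have hmp := Measure.measurePreserving_sub_left (volume : Measure ℝ) y
  have hemb : MeasurableEmbedding fun v : ℝ => y - v :=
    (MeasurableEquiv.subLeft y).measurableEmbedding
  have hpre : (fun v : ℝ => y - v) ⁻¹' Iio y = Ioi 0 := by ext v; simp
  have hfun : ∀ v : ℝ, (y - (y - v)) ^ (μ - 1) * Real.exp ((y - v) * r) =
      v ^ (μ - 1) * Real.exp (-(r * v)) * Real.exp (y * r) := by
    intro v
    rw [mul_assoc, ← Real.exp_add]
    ring_nf
  have hval := Real.integral_rpow_mul_exp_neg_mul_Ioi hμ hr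
  have hint : IntegrableOn (fun v : ℝ => v ^ (μ - 1) * Real.exp (-(r * v))) (Ioi 0) :=
    .of_integral_ne_zero (by
      rw [hval]
      have := Real.Gamma_pos_of_pos hμ
      positivity)
  constructor
  · rw [← hmp.integrableOn_comp_preimage hemb, hpre]
    refine (hint.mul_const (Real.exp (y * r))).congr (ae_of_all _ fun v => ?_)
    exact (hfun v).symm
  · rw [← hmp.setIntegral_preimage_emb hemb, hpre]
    simp only [hfun]
    rw [integral_mul_const, hval, one_div, Real.inv_rpow hr.le, ← Real.rpow_neg hr.le]
    ring

section mgf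

variable {S : Type*} [MeasurableSpace S] {ρ : Measure S} [IsFiniteMeasure ρ] {X : S → ℝ}

/-- The Liouville integral of order `μ` of `exp (τ * X)` is `X ^ (-μ) * exp (y * X)`, and by
Fubini the same holds under an integral. -/
lemma liouville_mgf (hX : Measurable X) (hpos : ∀ᵐ s ∂ρ, 0 < X s) {μ : ℝ} (hμ : 0 < μ) {y : ℝ}
    (hint : Integrable (fun s => X s ^ (-μ) * Real.exp (y * X s)) ρ) :
    IntegrableOn (fun τ => (y - τ) ^ (μ - 1) * mgf X ρ τ) (Iio y) ∧
      1 / Real.Gamma μ * ∫ τ in Iio y, (y - τ) ^ (μ - 1) * mgf X ρ τ =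
        ∫ s, X s ^ (-μ) * Real.exp (y * X s) ∂ρ := by
  set F : ℝ × S → ℝ := fun p => (y - p.1) ^ (μ - 1) * Real.exp (p.1 * X p.2) with hF
  have hFm : Measurable F := by fun_prop
  have hinner : ∀ᵐ s ∂ρ, ∫ τ in Iio y, ‖F (τ, s)‖ =
      Real.Gamma μ * (X s ^ (-μ) * Real.exp (y * X s)) := by
    filter_upwards [hpos] with s hs
    rw [← (integrableOn_and_integral_rpow_mul_exp_Iio hμ hs y).2]
    refine setIntegral_congr_fun measurableSet_Iio fun τ hτ => ?_
    have : 0 < y - τ := sub_pos.2 hτ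
    exact Real.norm_of_nonneg (by positivity)
  have hFint : Integrable F ((volume.restrict (Iio y)).prod ρ) := by
    rw [integrable_prod_iff' hFm.aestronglyMeasurable]
    constructor
    · filter_upwards [hpos] with s hs
      exact (integrableOn_and_integral_rpow_mul_exp_Iio hμ hs y).1
    · exact (hint.const_mul _).congr (hinner.mono fun s hs => hs.symm)
  have hslice : ∀ τ, ∫ s, F (τ, s) ∂ρ = (y - τ) ^ (μ - 1) * mgf X ρ τ := by
    intro τ
    simp only [hF, mgf]
    rw [integral_const_mul]
  constructor
  · exact hFint.integral_prod_left.congr (ae_of_all _ hslice)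
  · simp only [← hslice]
    rw [integral_integral_swap (f := fun τ s => F (τ, s)) hFint]
    have hswap : ∫ s, (∫ τ in Iio y, F (τ, s)) ∂ρ =
        ∫ s, Real.Gamma μ * (X s ^ (-μ) * Real.exp (y * X s)) ∂ρ :=
      integral_congr_ae (hpos.mono fun s hs =>
        (integrableOn_and_integral_rpow_mul_exp_Iio hμ hs y).2)
    rw [hswap, integral_const_mul, ← mul_assoc,
      one_div_mul_cancel (Real.Gamma_pos_of_pos hμ).ne', one_mul]

lemma integrableExpSet_eq_univ_of_ae_bounded (hX : Measurable X) {t : ℝ}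
    (hle : ∀ᵐ s ∂ρ, |X s| ≤ t) : integrableExpSet X ρ = univ := by
  refine eq_univ_of_forall fun y => ?_
  refine Integrable.of_bound (C := Real.exp (|y| * t)) (by fun_prop) ?_
  filter_upwards [hle] with s hs
  rw [Real.norm_of_nonneg (Real.exp_pos _).le]
  refine Real.exp_le_exp.2 ((le_abs_self _).trans ?_)
  rw [abs_mul]
  gcongr

lemma contDiff_mgf_and_iteratedDeriv (hX : Measurable X) {t : ℝ} (hle : ∀ᵐ s ∂ρ, |X s| ≤ t)
    (m : ℕ) (y : ℝ) : ContDiff ℝ m (mgf X ρ) ∧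
      iteratedDeriv m (mgf X ρ) y = ∫ s, X s ^ m * Real.exp (y * X s) ∂ρ := by
  have h : interior (integrableExpSet X ρ) = univ := by
    rw [integrableExpSet_eq_univ_of_ae_bounded hX hle, interior_univ]
  have han := analyticOnNhd_mgf (X := X) (μ := ρ)
  rw [h] at han
  exact ⟨han.contDiff, iteratedDeriv_mgf (h ▸ mem_univ y) m⟩

end mgf

/-! ### Liouville derivatives of simplex integrals -/

lemma gammaWeight_update {k : ℕ} (a x : Fin k → ℝ) (i : Fin k) (b τ : ℝ) {s : Fin k → ℝ}
    (hs : 0 < s i) :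
    gammaWeight (Function.update a i (a i + b)) (Function.update x i τ) s =
      gammaWeight a (Function.update x i 0) s * (s i ^ b * Real.exp (τ * s i)) := by
  unfold gammaWeight
  rw [← Finset.mul_prod_erase _ _ (Finset.mem_univ i), ← Finset.mul_prod_erase (a := i) _
    (fun j => s j ^ a j * Real.exp (s j * Function.update x i 0 j)) (Finset.mem_univ i)]
  have h : ∀ j ∈ Finset.univ.erase i, s j ^ Function.update a i (a i + b) j *
      Real.exp (s j * Function.update x i τ j) =
        s j ^ a j * Real.exp (s j * Function.update x i 0 j) := by
    intro j hj
    have hji := Finset.ne_of_mem_erase hj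
    simp [Function.update_of_ne hji]
  rw [Finset.prod_congr rfl h]
  simp only [Function.update_self, mul_zero, Real.exp_zero, Real.rpow_add hs]
  ring_nf

/-- The measure on the simplex with respect to which the slice `τ ↦ simplexIntegral t a x`, with
`x i = τ`, is the moment generating function of the `i`-th coordinate. -/
def sliceMeasure {n : ℕ} (t : ℝ) (a x : Fin (n + 1) → ℝ) (i : Fin (n + 1)) :
    Measure (Fin (n + 1) → ℝ) :=
  (simplexMeasure n t).withDensity
    fun s => ENNReal.ofReal (gammaWeight a (Function.update x i 0) s)

section slice

variable {n : ℕ} {t : ℝ} {a : Fin (n + 1) → ℝ} (x : Fin (n + 1) → ℝ) (i : Fin (n + 1))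

lemma isFiniteMeasure_sliceMeasure (ht : 0 < t) (ha : ∀ j, -1 < a j) :
    IsFiniteMeasure (sliceMeasure t a x i) :=
  isFiniteMeasure_withDensity_ofReal (integrable_gammaWeight ha _ ht).2

lemma ae_sliceMeasure {p : (Fin (n + 1) → ℝ) → Prop} (h : ∀ᵐ s ∂simplexMeasure n t, p s) :
    ∀ᵐ s ∂sliceMeasure t a x i, p s :=
  (withDensity_absolutelyContinuous _ _).ae_le h

lemma toReal_smul_ae_eq_gammaWeight (b τ : ℝ) :
    (fun s => (ENNReal.ofReal (gammaWeight a (Function.update x i 0) s)).toReal •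
        (s i ^ b * Real.exp (τ * s i))) =ᵐ[simplexMeasure n t]
      gammaWeight (Function.update a i (a i + b)) (Function.update x i τ) := by
  filter_upwards [ae_simplexMeasure_pos n t] with s hs
  rw [gammaWeight_update a x i b τ (hs i), ENNReal.toReal_ofReal (gammaWeight_pos _ _ hs).le,
    smul_eq_mul]

lemma integral_sliceMeasure (b τ : ℝ) :
    ∫ s, s i ^ b * Real.exp (τ * s i) ∂sliceMeasure t a x i =
      simplexIntegral t (Function.update a i (a i + b)) (Function.update x i τ) := by
  rw [sliceMeasure, integral_withDensity_eq_integral_toReal_smul (by fun_prop)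
    (ae_of_all _ fun _ => ENNReal.ofReal_lt_top),
    integral_congr_ae (toReal_smul_ae_eq_gammaWeight x i b τ), simplexIntegral]

lemma integrable_sliceMeasure (ht : 0 < t) (ha : ∀ j, -1 < a j) {b : ℝ} (hb : -1 < a i + b)
    (τ : ℝ) : Integrable (fun s => s i ^ b * Real.exp (τ * s i)) (sliceMeasure t a x i) := by
  rw [sliceMeasure, integrable_withDensity_iff_integrable_smul' (by fun_prop)
    (ae_of_all _ fun _ => ENNReal.ofReal_lt_top),
    integrable_congr (toReal_smul_ae_eq_gammaWeight x i b τ)]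
  refine integrable_gammaWeight (fun j => ?_) _ ht
  rcases eq_or_ne j i with rfl | hj
  · simpa using hb
  · simpa [Function.update_of_ne hj] using ha j

lemma coordSlice_simplexIntegral :
    coordSlice (simplexIntegral t a) i x = mgf (fun s => s i) (sliceMeasure t a x i) := by
  funext τ
  have h := integral_sliceMeasure (t := t) (a := a) x i 0 τ
  simp only [Real.rpow_zero, one_mul, add_zero, Function.update_eq_self] at h
  exact h.symm

/-- A Liouville integral of order `μ` in the `i`-th variable lowers the exponent `a i` by `μ`. -/
lemma liouville_simplexIntegral (ht : 0 < t) (ha : ∀ j, -1 < a j) {μ : ℝ} (hμ : 0 ≤ μ)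
    (hμa : -1 < a i - μ) :
    LiouvilleIntegrable μ (coordSlice (simplexIntegral t a) i x) (x i) ∧
      liouvilleIntegral μ (coordSlice (simplexIntegral t a) i x) (x i) =
        simplexIntegral t (Function.update a i (a i - μ)) x := by
  rcases hμ.eq_or_lt with rfl | hμ
  · exact ⟨Or.inl rfl, by simp [liouvilleIntegral, coordSlice]⟩
  · have := isFiniteMeasure_sliceMeasure x i ht ha
    have h := liouville_mgf (ρ := sliceMeasure t a x i) (measurable_pi_apply i)
      (ae_sliceMeasure x i ((ae_simplexMeasure_pos n t).mono fun s hs => hs i)) hμ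
      (integrable_sliceMeasure x i ht ha (b := -μ) (by linarith) (x i))
    rw [integral_sliceMeasure, Function.update_eq_self, ← sub_eq_add_neg] at h
    rw [liouvilleIntegral, if_neg hμ.ne', coordSlice_simplexIntegral]
    exact ⟨Or.inr h.1, h.2⟩

/-- Each derivative in the `i`-th variable raises the exponent `a i` by one. -/
lemma iteratedDeriv_simplexIntegral (ht : 0 < t) (ha : ∀ j, -1 < a j) (m : ℕ) :
    ContDiff ℝ m (coordSlice (simplexIntegral t a) i x) ∧
      iteratedDeriv m (coordSlice (simplexIntegral t a) i x) (x i) =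
        simplexIntegral t (Function.update a i (a i + m)) x := by
  have := isFiniteMeasure_sliceMeasure x i ht ha
  have hle : ∀ᵐ s ∂sliceMeasure t a x i, |s i| ≤ t := ae_sliceMeasure x i (by
    filter_upwards [ae_simplexMeasure_pos n t, ae_simplexMeasure_le n t] with s hs hst
    rw [abs_of_pos (hs i)]
    exact hst i)
  have h := contDiff_mgf_and_iteratedDeriv (measurable_pi_apply i) hle m (x i)
  simp only [← Real.rpow_natCast] at h
  rw [integral_sliceMeasure, Function.update_eq_self] at h
  rwa [coordSlice_simplexIntegral]

end slice

lemma iterLiouville_simplexIntegral {n : ℕ} {t : ℝ} (ht : 0 < t) {a μ : Fin (n + 1) → ℝ}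
    (hμ : ∀ j, 0 ≤ μ j) (ha : ∀ j, -1 < a j - μ j) {l : List (Fin (n + 1))} (hl : l.Nodup) :
    IterLiouvilleIntegrable μ (simplexIntegral t a) l ∧
      iterLiouvilleIntegral μ (simplexIntegral t a) l =
        simplexIntegral t fun j => if j ∈ l then a j - μ j else a j := by
  induction l with
  | nil => exact ⟨trivial, by simp [iterLiouvilleIntegral]⟩
  | cons i l ih =>
    obtain ⟨hi, hl⟩ := List.nodup_cons.1 hl
    obtain ⟨ih1, ih2⟩ := ih hl
    have hb : ∀ j, -1 < if j ∈ l then a j - μ j else a j := by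
      intro j
      split_ifs
      · exact ha j
      · linarith [ha j, hμ j]
    have hstep := fun x => liouville_simplexIntegral x i ht hb (hμ i)
      (by rw [if_neg hi]; exact ha i)
    refine ⟨⟨ih1, fun x => ?_⟩, ?_⟩
    · rw [ih2]
      exact (hstep x).1
    · funext x
      simp only [iterLiouvilleIntegral, ih2, (hstep x).2]
      congr 1
      funext j
      rcases eq_or_ne j i with rfl | hj
      · simp [hi]
      · simp [hj]

lemma iterPartialDeriv_simplexIntegral {n : ℕ} {t : ℝ} (ht : 0 < t) {a : Fin (n + 1) → ℝ}
    (m : Fin (n + 1) → ℕ) (ha : ∀ j, -1 < a j) {l : List (Fin (n + 1))} (hl : l.Nodup) :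
    IterPartialDifferentiable m (simplexIntegral t a) l ∧
      iterPartialDeriv m (simplexIntegral t a) l =
        simplexIntegral t fun j => if j ∈ l then a j + m j else a j := by
  induction l with
  | nil => exact ⟨trivial, by simp [iterPartialDeriv]⟩
  | cons i l ih =>
    obtain ⟨hi, hl⟩ := List.nodup_cons.1 hl
    obtain ⟨ih1, ih2⟩ := ih hl
    have hb : ∀ j, -1 < if j ∈ l then a j + m j else a j := by
      intro j
      split_ifs
      · linarith [ha j, (m j).cast_nonneg (α := ℝ)]
      · exact ha j
    have hstep := fun x => iteratedDeriv_simplexIntegral x i ht hb (m i)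
    refine ⟨⟨ih1, fun x => ?_⟩, ?_⟩
    · rw [ih2]
      exact (hstep x).1
    · funext x
      simp only [iterPartialDeriv, ih2, (hstep x).2]
      congr 1
      funext j
      rcases eq_or_ne j i with rfl | hj
      · simp [hi]
      · simp [hj]

/-- The mixed Liouville derivative of orders `ν i` of `e[x₀, …, xₙ]` inserts the factors
`s i ^ ν i` into the Hermite–Genocchi integral. -/
lemma mixedLiouville_expDivDiff {n : ℕ} {t : ℝ} (ht : 0 < t) {ν : Fin (n + 1) → ℝ}
    (hν : ∀ j, -1 < ν j) :
    MixedLiouvilleDifferentiable ν (expDivDiff n t) ∧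
      mixedLiouvilleDeriv ν (expDivDiff n t) = simplexIntegral t ν := by
  have hμ : ∀ j, 0 ≤ (liouvilleDegree ν j : ℝ) - ν j := fun j => sub_nonneg.2 (Nat.le_ceil _)
  have ha : ∀ j, -1 < (0 : Fin (n + 1) → ℝ) j - ((liouvilleDegree ν j : ℝ) - ν j) := by
    intro j
    rw [Pi.zero_apply, liouvilleDegree]
    rcases le_or_gt 0 (ν j) with h | h
    · linarith [Nat.ceil_lt_add_one h]
    · rw [Nat.ceil_eq_zero.2 h.le]
      simpa using hν j
  have h1 := iterLiouville_simplexIntegral ht hμ ha (List.nodup_finRange (n + 1))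
  have h2 := iterPartialDeriv_simplexIntegral ht (liouvilleDegree ν) ha
    (List.nodup_finRange (n + 1))
  simp only [List.mem_finRange, if_true] at h1 h2
  rw [← expDivDiff_eq_simplexIntegral ht] at h1
  -- After the integrals the exponents are `ν j - m j`, where `m j` is the degree in `x j`; the
  -- derivatives then add `m j`.
  have h3 : mixedLiouvilleIntegral ν (expDivDiff n t) = _ := h1.2
  rw [MixedLiouvilleDifferentiable, mixedLiouvilleDeriv, h3]
  refine ⟨⟨h1.1, h2.1⟩, h2.2.trans ?_⟩
  congr 1
  funext j
  simp

/-! ### The density of a sum of independent gamma variables -/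

lemma simplexMeasure_eq_zero_of_nonpos (n : ℕ) {t : ℝ} (ht : t ≤ 0) : simplexMeasure n t = 0 := by
  rw [← ae_eq_bot, ← Filter.eventually_false_iff_eq_bot]
  filter_upwards [ae_simplexMeasure_pos n t, ae_simplexMeasure_sum n t] with s hs hst
  exact (Finset.sum_pos (fun i _ => hs i) Finset.univ_nonempty).not_ge (hst.trans_le ht)

lemma gammaSumDensity_eq {n : ℕ} {α : Fin (n + 1) → ℝ} (β : Fin (n + 1) → ℝ) (hα : ∀ i, 0 < α i)
    {t : ℝ} (ht : 0 < t) : gammaSumDensity α β t =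
      (∏ i, β i ^ α i / Real.Gamma (α i)) *
        simplexIntegral t (fun i => α i - 1) (fun i => -β i) := by
  rw [gammaSumDensity, (mixedLiouville_expDivDiff ht fun j => by linarith [hα j]).2]

lemma prod_gamma_normalization_nonneg {k : ℕ} {α β : Fin k → ℝ} (hα : ∀ i, 0 < α i)
    (hβ : ∀ i, 0 < β i) : 0 ≤ ∏ i, β i ^ α i / Real.Gamma (α i) :=
  Finset.prod_nonneg fun i _ =>
    div_nonneg (Real.rpow_nonneg (hβ i).le _) (Real.Gamma_pos_of_pos (hα i)).le

lemma gammaSumDensity_nonneg {n : ℕ} {α β : Fin (n + 1) → ℝ} (hα : ∀ i, 0 < α i)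
    (hβ : ∀ i, 0 < β i) {t : ℝ} (ht : 0 < t) : 0 ≤ gammaSumDensity α β t := by
  rw [gammaSumDensity_eq β hα ht]
  exact mul_nonneg (prod_gamma_normalization_nonneg hα hβ) (simplexIntegral_nonneg _ _ _)

/-- For `t ≤ 0` both sides vanish, the simplex being empty. -/
lemma ofReal_indicator_gammaSumDensity {n : ℕ} {α β : Fin (n + 1) → ℝ} (hα : ∀ i, 0 < α i)
    (hβ : ∀ i, 0 < β i) (t : ℝ) :
    ENNReal.ofReal ((Ioi (0 : ℝ)).indicator (gammaSumDensity α β) t) =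
      ENNReal.ofReal (∏ i, β i ^ α i / Real.Gamma (α i)) *
        ∫⁻ s, ENNReal.ofReal (gammaWeight (fun i => α i - 1) (fun i => -β i) s)
          ∂simplexMeasure n t := by
  rcases lt_or_ge 0 t with ht | ht
  · rw [indicator_of_mem (mem_Ioi.2 ht), gammaSumDensity_eq β hα ht,
      ENNReal.ofReal_mul (prod_gamma_normalization_nonneg hα hβ), simplexIntegral,
      ofReal_integral_eq_lintegral_ofReal
        (integrable_gammaWeight (fun i => by linarith [hα i]) _ ht)
        ((ae_simplexMeasure_pos n t).mono fun _ hs => (gammaWeight_pos _ _ hs).le)]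
  · rw [indicator_of_notMem (notMem_Ioi.2 ht), simplexMeasure_eq_zero_of_nonpos n ht]
    simp

lemma measurable_indicator_gammaSumDensity {n : ℕ} {α β : Fin (n + 1) → ℝ} (hα : ∀ i, 0 < α i)
    (hβ : ∀ i, 0 < β i) : Measurable ((Ioi (0 : ℝ)).indicator (gammaSumDensity α β)) := by
  have h : (Ioi (0 : ℝ)).indicator (gammaSumDensity α β) = fun t =>
      (ENNReal.ofReal ((Ioi (0 : ℝ)).indicator (gammaSumDensity α β) t)).toReal := by
    funext t
    exact (ENNReal.toReal_ofReal
      (indicator_nonneg (fun t ht => gammaSumDensity_nonneg hα hβ (mem_Ioi.1 ht)) t)).symm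
  rw [h]
  simp only [ofReal_indicator_gammaSumDensity hα hβ]
  exact ((measurable_lintegral_simplexMeasure (by fun_prop)).const_mul _).ennreal_toReal

/-- Mathlib's density `gammaPDF` need not vanish at `0`; this one is supported in the open
half-line. -/
lemma gammaMeasure_eq_withDensity_Ioi {a r : ℝ} (ha : 0 < a) (hr : 0 < r) :
    gammaMeasure a r = volume.withDensity fun v => ENNReal.ofReal (r ^ a / Real.Gamma a) *
      (Ioi (0 : ℝ)).indicator (fun v => ENNReal.ofReal (v ^ (a - 1) * Real.exp (v * -r))) v := by
  refine withDensity_congr_ae ?_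
  filter_upwards [compl_mem_ae_iff.2 (measure_singleton (0 : ℝ))] with v hv
  rcases lt_or_gt_of_ne (show v ≠ 0 from hv) with h | h
  · rw [gammaPDF_of_neg h, indicator_of_notMem (notMem_Ioi.2 h.le), mul_zero]
  · have hc : 0 ≤ r ^ a / Real.Gamma a :=
      div_nonneg (Real.rpow_nonneg hr.le _) (Real.Gamma_pos_of_pos ha).le
    rw [gammaPDF_of_nonneg h.le, indicator_of_mem (mem_Ioi.2 h), ← ENNReal.ofReal_mul hc]
    ring_nf

lemma pi_gammaMeasure_eq_withDensity {k : ℕ} {α β : Fin k → ℝ} (hα : ∀ i, 0 < α i)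
    (hβ : ∀ i, 0 < β i) :
    Measure.pi (fun i => gammaMeasure (α i) (β i)) = volume.withDensity fun z =>
      ENNReal.ofReal (∏ i, β i ^ α i / Real.Gamma (α i)) * (posOrthant k).indicator
        (fun s => ENNReal.ofReal (gammaWeight (fun i => α i - 1) (fun i => -β i) s)) z := by
  have hprob := fun i => isProbabilityMeasure_gammaMeasure (hα i) (hβ i)
  have heq := fun i => gammaMeasure_eq_withDensity_Ioi (hα i) (hβ i)
  simp only [heq] at hprob ⊢
  rw [pi_withDensity_eq fun i => (Measurable.indicator (by fun_prop) measurableSet_Ioi).const_mul _]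
  congr 1
  funext z
  rw [Finset.prod_mul_distrib, indicator_ofReal_gammaWeight,
    ENNReal.ofReal_prod_of_nonneg fun i _ =>
      div_nonneg (Real.rpow_nonneg (hβ i).le _) (Real.Gamma_pos_of_pos (hα i)).le]

lemma map_sum_pi_gammaMeasure {n : ℕ} {α β : Fin (n + 1) → ℝ} (hα : ∀ i, 0 < α i)
    (hβ : ∀ i, 0 < β i) :
    (Measure.pi fun i => gammaMeasure (α i) (β i)).map (fun z => ∑ i, z i) =
      volume.withDensity
        (fun t => ENNReal.ofReal ((Ioi (0 : ℝ)).indicator (gammaSumDensity α β) t)) := by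
  have hsum : Measurable fun z : Fin (n + 1) → ℝ => ∑ i, z i := by fun_prop
  have hW : Measurable fun s : Fin (n + 1) → ℝ =>
    ENNReal.ofReal (gammaWeight (fun i => α i - 1) (fun i => -β i) s) := by fun_prop
  ext A hA
  rw [Measure.map_apply hsum hA, pi_gammaMeasure_eq_withDensity hα hβ,
    withDensity_apply _ (hsum hA), withDensity_apply _ hA,
    ← lintegral_indicator (hsum hA), ← lintegral_indicator hA]
  have h := lintegral_lintegral_simplexMeasure (n := n) hW
    (φ := A.indicator fun _ => ENNReal.ofReal (∏ i, β i ^ α i / Real.Gamma (α i)))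
    (measurable_const.indicator hA)
  refine Eq.trans (lintegral_congr fun z => ?_) (h.symm.trans (lintegral_congr fun t => ?_))
  · by_cases hz : ∑ i, z i ∈ A
    · rw [indicator_of_mem (show z ∈ (fun z : Fin (n + 1) → ℝ => ∑ i, z i) ⁻¹' A from hz),
        indicator_of_mem hz]
    · rw [indicator_of_notMem (show z ∉ (fun z : Fin (n + 1) → ℝ => ∑ i, z i) ⁻¹' A from hz),
        indicator_of_notMem hz, zero_mul]
  · by_cases ht : t ∈ A
    · rw [indicator_of_mem ht, indicator_of_mem ht, ofReal_indicator_gammaSumDensity hα hβ]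
    · rw [indicator_of_notMem ht, indicator_of_notMem ht, zero_mul]

end

theorem proposition8p1 {Ω : Type*} [MeasurableSpace Ω] (P : Measure Ω) [IsProbabilityMeasure P]
    (n : ℕ) (α β : Fin (n + 1) → ℝ) (hα : ∀ i, 0 < α i) (hβ : ∀ i, 0 < β i)
    (hne : ∀ i j, i ≠ j → (α i, β i) ≠ (α j, β j))
    (Z : Fin (n + 1) → Ω → ℝ) (hZ : ∀ i, HasLaw (Z i) (gammaMeasure (α i) (β i)) P)
    (hind : iIndepFun Z P) :
    (∀ t : ℝ, 0 < t → MixedLiouvilleDifferentiable (fun i => α i - 1) (expDivDiff n t)) ∧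
    (∀ t : ℝ, 0 < t → 0 ≤ gammaSumDensity α β t) ∧
    Measurable ((Ioi (0 : ℝ)).indicator (gammaSumDensity α β)) ∧
    HasLaw (fun ω => ∑ i, Z i ω)
      (volume.withDensity
        (fun t => ENNReal.ofReal ((Ioi (0 : ℝ)).indicator (gammaSumDensity α β) t))) P := by
  refine ⟨fun t ht => (mixedLiouville_expDivDiff ht fun j => by linarith [hα j]).1,
    fun t ht => gammaSumDensity_nonneg hα hβ ht, measurable_indicator_gammaSumDensity hα hβ,
    Finset.aemeasurable_fun_sum _ fun i _ => (hZ i).aemeasurable, ?_⟩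
  have hm : AEMeasurable (fun ω i => Z i ω) P :=
    aemeasurable_pi_lambda _ fun i => (hZ i).aemeasurable
  have hmap := (iIndepFun_iff_map_fun_eq_pi_map fun i => (hZ i).aemeasurable).1 hind
  simp only [(hZ _).map_eq] at hmap
  rw [← map_sum_pi_gammaMeasure hα hβ, ← hmap, AEMeasurable.map_map_of_aemeasurable
    (Measurable.aemeasurable (by fun_prop)) hm]
  rfl
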